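/- Let $U$ (offline vertices) and $B$ (type nodes) be finite sets and let $H_{\mathrm{typ}}=(U,B,F)$, $F=U\times B$, be a type graph with real edge weights $(w_f)_{f\in F}$, edge probabilities $(p_f)_{f\in F}\subseteq[0,1]$ and, for every $b\in B$, an online probing constraint $\mathcal C_b$: a set of strings of pairwise distinct edges of $\partial(b)=U\times\{b\}$ that contains the empty string and is downward-closed (every substring and every permutation of a member is a member). Let $n\ge 0$ and let $\mathcal D_1,\dots,\mathcal D_n$ be probability distributions on $B$; write $r_i(b)=\mathcal D_i(b)$. The random stochastic graph $G\sim(H_{\mathrm{typ}},(\mathcal D_i)_{i=1}^n)$ has offline vertices $U$ and online vertices $v_1,\dots,v_n$, where $v_i$ is a copy of a type node drawn from $\mathcal D_i$, independently for different $i$; the edges at $v_i$ inherit the weights, the probabilities and the probing constraint of the type of $v_i$ (different $v_i$ of the same type have separate edges). Given $G$, each edge $e$ is active independently with probability $p_e$. An offline probing algorithm knows $G$ but not which edges are active. It may probe edges one at a time, in any order, adaptively and possibly with randomization; a probe reveals whether the edge is active, and if it is, the algorithm must decide irrevocably, before any further probe, whether to add the edge to its matching. At every $v_i$ the string of probed edges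 must belong to the constraint $\mathcal C_{v_i}$, and the accepted edges must form a matching. $\mathrm{OPT}(G)$ is the maximum over all offline probing algorithms of the expected total weight of the matching returned. For a string $\bm e$ of edges put $q(\bm e)=\prod_{f\in\bm e}(1-p_f)$ (so $q$ of the empty string is $1$), let $\bm e_{<f}$ be the part of $\bm e$ before the edge $f$, and $\mathrm{val}(\bm e)=\sum_{f\in\bm e}w_f\,p_f\,q(\bm e_{<f})$. Let $\mathrm{LPOPT}(H_{\mathrm{typ}},(\mathcal D_i)_{i=1}^n)$ be the optimum value of the linear program (LP-config-id) in the variables $x_i(\bm e\,\|\,b)$, $i\in[n]$, $b\in B$, $\bm e\in\mathcal C_b$: \begin{align*} \text{maximize}\quad & \sum_{i\in[n],\,b\in B,\,\bm e\in\mathcal C_b}\mathrm{val}(\bm e)\,x_i(\bm e\,\|\,b)\\ \text{subject to}\quad & \sum_{i\in[n],\,b\in B}\ \sum_{\bm e\in\mathcal C_b:\,(u,b)\in\bm e}p_{u,b}\,q(\bm e_{<(u,b)})\,x_i(\bm e\,\|\,b)\le 1 && \forall u\in U,\\ & \sum_{\bm e\in\mathcal C_b}x_i(\bm e\,\|\,b)=r_i(b)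 && \forall i\in[n],\ b\in B,\\ & x_i(\bm e\,\|\,b)\ge 0 && \forall i\in[n],\ b\in B,\ \bm e\in\mathcal C_b . \end{align*} Theorem. The maxima that define $\mathrm{OPT}(G)$ (for every possible $G$) and $\mathrm{LPOPT}(H_{\mathrm{typ}},(\mathcal D_i)_{i=1}^n)$ exist, and $$\mathbb E[\mathrm{OPT}(G)]\ \le\ \mathrm{LPOPT}(H_{\mathrm{typ}},(\mathcal D_i)_{i=1}^n),$$ where the expectation is over $G\sim(H_{\mathrm{typ}},(\mathcal D_i)_{i=1}^n)$. -/

import Mathlib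

noncomputable section

open scoped BigOperators

/-- A (bipartite) stochastic graph with offline vertices `U`, vertices `V` on the other side, and
edge set `U × V`, with edge weights `w`, edge probabilities `p` and online probing constraints `C`.
An edge `(u, v)` of `∂(v)` is recorded by its offline endpoint `u`, so a string of edges of `∂(v)`
is a list over `U`. A type graph is a stochastic graph whose vertices `V` are the type nodes. -/
structure StochasticGraph (U V : Type*) where
  /-- edge weights -/
  w : U → V → ℝ
  /-- edge probabilities -/
  p : U → V → ℝ
  p_nonneg : ∀ u v, 0 ≤ p u v
  p_le_one : ∀ u v, p u v ≤ 1
  /-- the strings of edges of `∂(v)` that may be probed, in this order -/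
  C : V → Finset (List U)
  /-- the characters of a string are distinct -/
  nodup_of_mem : ∀ v, ∀ e ∈ C v, e.Nodup
  /-- probing nothing is allowed -/
  nil_mem : ∀ v, [] ∈ C v
  /-- `C v` is downward-closed: it contains the substrings of its members ... -/
  mem_of_infix : ∀ v, ∀ e ∈ C v, ∀ e' : List U, e' <:+: e → e' ∈ C v
  /-- ... and the permutations of its members. -/
  mem_of_perm : ∀ v, ∀ e ∈ C v, ∀ e' : List U, e'.Perm e → e' ∈ C v

/-- A deterministic adaptive probing strategy, as a decision tree. At a node
`probe u v acc active inactive` the edge `(u, v)` is probed. If it is active, it is added to the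
matching exactly when `acc = true` (the commitment, made before any further probe), and the
strategy goes on with `active`; if it is inactive, the strategy goes on with `inactive`. -/
inductive ProbingTree (U V : Type*) where
  | halt : ProbingTree U V
  | probe (u : U) (v : V) (acc : Bool) (active inactive : ProbingTree U V) : ProbingTree U V

namespace ProbingTree

variable {U V : Type*} [DecidableEq U] [DecidableEq V]

/-- The set of edges returned by the strategy when the edge states are `st`. -/
def run (st : U × V → Bool) : ProbingTree U V → Finset (U × V)
  | halt => ∅
  | probe u v acc active inactive =>
    if st (u, v) then
      if acc then insert (u, v) (run st active) else run st active
    else run st inactive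

/-- The strategy may be followed from the situation in which `s v` is the string of edges of `∂(v)`
probed so far (for each `v`) and `M` is the current matching: the probed strings respect the
probing constraints, and an edge is accepted only if both of its endpoints are unmatched. -/
def ValidFrom (G : StochasticGraph U V) :
    ProbingTree U V → (V → List U) → Finset (U × V) → Prop
  | halt, _, _ => True
  | probe u v acc active inactive, s, M =>
    s v ++ [u] ∈ G.C v ∧
    (acc = true → ∀ f ∈ M, f.1 ≠ u ∧ f.2 ≠ v) ∧
    ValidFrom G active (Function.update s v (s v ++ [u])) (if acc then insert (u, v) M else M) ∧
    ValidFrom G inactive (Function.update s v (s v ++ [u])) M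

end ProbingTree

namespace StochasticGraph

section Offline

variable {U V : Type*} [Fintype U] [DecidableEq U] [Fintype V] [DecidableEq V]

/-- The deterministic offline probing algorithms for `G`. -/
def DetAlg (G : StochasticGraph U V) : Type _ :=
  {A : ProbingTree U V // A.ValidFrom G (fun _ => []) ∅}

/-- The probability of the edge states `st`: the edges are active independently, the edge `e`
with probability `p e`. -/
def stateProb (G : StochasticGraph U V) (st : U × V → Bool) : ℝ :=
  ∏ e : U × V, if st e then G.p e.1 e.2 else 1 - G.p e.1 e.2

/-- The expected weight of the matching returned by a deterministic algorithm. -/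
def detValue (G : StochasticGraph U V) (A : G.DetAlg) : ℝ :=
  ∑ st : U × V → Bool, G.stateProb st * ∑ e ∈ A.1.run st, G.w e.1 e.2

/-- An offline probing algorithm may be randomized: it is a probability distribution on the
deterministic ones. This is the expected weight of the matching that it returns. -/
def algValue (G : StochasticGraph U V) (μ : PMF G.DetAlg) : ℝ :=
  ∑' A : G.DetAlg, (μ A).toReal * G.detValue A

/-- The expected weights that the offline probing algorithms attain on `G`. -/
def offlineValues (G : StochasticGraph U V) : Set ℝ :=
  Set.range G.algValue

/-- `OPT(G)`, the value of the offline adaptive benchmark on `G`. -/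
def OPT (G : StochasticGraph U V) : ℝ :=
  sSup G.offlineValues

end Offline

section KnownID

variable {U B : Type*} [DecidableEq U]

/-- `q(e)`, the probability that all edges of the string `e` of `∂(b)` are inactive. -/
def q (H : StochasticGraph U B) (b : B) (e : List U) : ℝ :=
  (e.map fun u => 1 - H.p u b).prod

/-- `q(e_{<u})`, where `e_{<u}` consists of the edges of `e` before `(u, b)`. -/
def qBefore (H : StochasticGraph U B) (b : B) (e : List U) (u : U) : ℝ :=
  H.q b (e.takeWhile fun u' => u' ≠ u)

/-- `val(e)`, the sum of `w_f * p_f * q(e_{<f})` over the edges `f` of the string `e` of `∂(b)`. -/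
def val (H : StochasticGraph U B) (b : B) (e : List U) : ℝ :=
  (e.map fun u => H.w u b * H.p u b * H.qBefore b e u).sum

/-- The stochastic graph with online vertices `v_1, …, v_n`, where `v_i` is a copy of the type
node `τ i` (distinct `v_i` of the same type have distinct, independent edges). -/
def sample (H : StochasticGraph U B) {n : ℕ} (τ : Fin n → B) : StochasticGraph U (Fin n) where
  w u i := H.w u (τ i)
  p u i := H.p u (τ i)
  p_nonneg u i := H.p_nonneg u (τ i)
  p_le_one u i := H.p_le_one u (τ i)
  C i := H.C (τ i)
  nodup_of_mem i := H.nodup_of_mem (τ i)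
  nil_mem i := H.nil_mem (τ i)
  mem_of_infix i := H.mem_of_infix (τ i)
  mem_of_perm i := H.mem_of_perm (τ i)

variable [Fintype U] [Fintype B]

/-- `E[OPT(G)]` for `G` drawn from the known i.d. input `(H, (D_1, …, D_n))`: the type of `v_i` is
drawn from `D_i`, independently for `i = 1, …, n`. -/
def expectedOPT (H : StochasticGraph U B) {n : ℕ} (D : Fin n → PMF B) : ℝ :=
  ∑ τ : Fin n → B, (∏ i, (D i (τ i)).toReal) * (H.sample τ).OPT

/-- Feasibility for LP-config-id. The decision variables are `x i b e` for `e ∈ C b`; the values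
for other `e` play no role. -/
structure LPFeasible (H : StochasticGraph U B) {n : ℕ} (D : Fin n → PMF B)
    (x : Fin n → B → List U → ℝ) : Prop where
  matching : ∀ u : U,
    ∑ i, ∑ b, ∑ e ∈ H.C b with u ∈ e, H.p u b * H.qBefore b e u * x i b e ≤ 1
  distribution : ∀ i b, ∑ e ∈ H.C b, x i b e = (D i b).toReal
  nonneg : ∀ i b, ∀ e ∈ H.C b, 0 ≤ x i b e

/-- The objective function of LP-config-id. -/
def lpObjective (H : StochasticGraph U B) {n : ℕ} (x : Fin n → B → List U → ℝ) : ℝ :=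
  ∑ i, ∑ b, ∑ e ∈ H.C b, H.val b e * x i b e

/-- The objective values of the feasible solutions to LP-config-id. -/
def lpValues (H : StochasticGraph U B) {n : ℕ} (D : Fin n → PMF B) : Set ℝ :=
  {t | ∃ x, H.LPFeasible D x ∧ H.lpObjective x = t}

/-- The optimum value of LP-config-id. -/
def LPOPT (H : StochasticGraph U B) {n : ℕ} (D : Fin n → PMF B) : ℝ :=
  sSup (H.lpValues D)

end KnownID

end StochasticGraph

end

/-! Fix the types, hence the graph, and an optimal deterministic algorithm. Seen from one online
vertex `v`, every event elsewhere is mere randomization, a probe without acceptance can be skipped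
because the constraint is downward-closed, and after an acceptance nothing more happens at `v`. So
the acceptance probabilities at `v` form a convex combination of the vectors `firstActiveProb` of
strings in `C v` (`marginal_mem_continuationHull`, by induction on the decision tree). Averaging
these mixtures over the types gives `mixedSolution`. It satisfies the matching constraints because
every realized output uses each offline vertex at most once, and its objective value is exactly
`expectedOPT` (`expectedOPT_mem_lpValues`). -/

namespace ProbingTree

/-! ### Decision trees -/

variable {U V : Type*} [DecidableEq U] [DecidableEq V]

/-- A valid strategy does not look again at an edge that has been probed. -/
theorem run_update_of_mem {G : StochasticGraph U V} (A : ProbingTree U V) {s : V → List U}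
    {M : Finset (U × V)} (hA : A.ValidFrom G s M) {u : U} {v : V} (hu : u ∈ s v)
    (st : U × V → Bool) (b : Bool) : A.run (Function.update st (u, v) b) = A.run st := by
  induction A generalizing s M with
  | halt => rfl
  | probe u' v' acc active inactive ih₁ ih₂ =>
    obtain ⟨hC, -, h₁, h₂⟩ := hA
    have hne : (u', v') ≠ (u, v) := by
      intro h
      obtain ⟨rfl, rfl⟩ := Prod.mk.inj h
      have hnd := G.nodup_of_mem _ _ hC
      rw [List.nodup_append] at hnd
      exact hnd.2.2 _ hu _ (by simp) rfl
    have hmem : u ∈ Function.update s v' (s v' ++ [u']) v := by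
      rcases eq_or_ne v v' with rfl | h
      · simp [hu]
      · simpa [Function.update_of_ne h] using hu
    simp only [run, Function.update_of_ne hne, ih₁ h₁ hmem, ih₂ h₂ hmem]

/-- The edges that a valid strategy accepts are disjoint from those accepted earlier. -/
theorem disjoint_of_mem_run {G : StochasticGraph U V} (A : ProbingTree U V) {s : V → List U}
    {M : Finset (U × V)} (hA : A.ValidFrom G s M) {st : U × V → Bool} {f g : U × V}
    (hf : f ∈ M) (hg : g ∈ A.run st) : f.1 ≠ g.1 ∧ f.2 ≠ g.2 := by
  induction A generalizing s M with
  | halt => simp [run] at hg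
  | probe u v acc active inactive ih₁ ih₂ =>
    obtain ⟨-, hacc, h₁, h₂⟩ := hA
    cases hst : st (u, v) <;> cases acc <;> simp only [run, hst, if_true, if_false,
      Bool.false_eq_true, Finset.mem_insert] at hg h₁
    · exact ih₂ h₂ hf hg
    · exact ih₂ h₂ hf hg
    · exact ih₁ h₁ hf hg
    · rcases hg with rfl | hg
      · exact hacc rfl f hf
      · exact ih₁ h₁ (Finset.mem_insert_of_mem hf) hg

/-- A valid strategy matches every offline vertex at most once. -/
theorem eq_of_mem_run {G : StochasticGraph U V} (A : ProbingTree U V) {s : V → List U}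
    {M : Finset (U × V)} (hA : A.ValidFrom G s M) {st : U × V → Bool} {f g : U × V}
    (hf : f ∈ A.run st) (hg : g ∈ A.run st) (h : f.1 = g.1) : f = g := by
  induction A generalizing s M with
  | halt => simp [run] at hg
  | probe u v acc active inactive ih₁ ih₂ =>
    obtain ⟨-, hacc, h₁, h₂⟩ := hA
    cases hst : st (u, v) <;> cases acc <;> simp only [run, hst, if_true, if_false,
      Bool.false_eq_true, Finset.mem_insert] at hf hg h₁
    · exact ih₂ h₂ hf hg
    · exact ih₂ h₂ hf hg
    · exact ih₁ h₁ hf hg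
    · rcases hf with rfl | hf <;> rcases hg with rfl | hg
      · rfl
      · exact absurd h (disjoint_of_mem_run _ h₁ (Finset.mem_insert_self _ _) hg).1
      · exact absurd h.symm (disjoint_of_mem_run _ h₁ (Finset.mem_insert_self _ _) hf).1
      · exact ih₁ h₁ hf hg

end ProbingTree

namespace StochasticGraph

/-! ### Strings at one vertex and their convex hulls -/

section Strings

variable {U V : Type*} [DecidableEq U]

/-- The probability that the edge at `u` is the first active one when the string `e` is probed. -/
def firstActiveProb (G : StochasticGraph U V) (v : V) (e : List U) (u : U) : ℝ :=
  if u ∈ e then G.p u v * G.qBefore v e u else 0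

theorem firstActiveProb_nil (G : StochasticGraph U V) (v : V) : G.firstActiveProb v [] = 0 := by
  ext u; simp [firstActiveProb]

theorem firstActiveProb_cons (G : StochasticGraph U V) (v : V) {u : U} {e : List U}
    (hu : u ∉ e) : G.firstActiveProb v (u :: e) =
      G.p u v • Pi.single u 1 + (1 - G.p u v) • G.firstActiveProb v e := by
  ext u'
  rcases eq_or_ne u' u with rfl | h
  · simp [firstActiveProb, qBefore, q, hu]
  · by_cases hm : u' ∈ e <;> simp [firstActiveProb, qBefore, q, h, h.symm, hm]
    ring

theorem val_eq_sum [Fintype U] (G : StochasticGraph U V) (v : V) {e : List U} (he : e.Nodup) :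
    G.val v e = ∑ u, G.w u v * G.firstActiveProb v e u := by
  simp only [val, ← List.sum_toFinset _ he, firstActiveProb, mul_ite, mul_zero,
    ← List.mem_toFinset, Finset.sum_ite_mem, Finset.univ_inter, mul_assoc]

/-- The convex hull of the vectors `firstActiveProb` of the strings that can be probed after `s`. -/
def continuationHull (G : StochasticGraph U V) (v : V) (s : List U) : Set (U → ℝ) :=
  convexHull ℝ (G.firstActiveProb v '' {e | s ++ e ∈ G.C v})

/-- Downward closure lets `u` be skipped: permute it to the front of the string, then drop it. -/
theorem continuationHull_append_subset (G : StochasticGraph U V) (v : V) (s : List U) (u : U) :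
    G.continuationHull v (s ++ [u]) ⊆ G.continuationHull v s := by
  refine convexHull_mono (Set.image_mono fun e he => ?_)
  have h₁ : u :: (s ++ e) ∈ G.C v :=
    G.mem_of_perm v _ he _ (by simpa using List.perm_middle.symm)
  exact G.mem_of_infix v _ h₁ _ (List.suffix_cons _ _).isInfix

/-- The affine map `φ` sends the vector of `e` to that of `u :: e`; it is enough to check this on
the generators of the hull. -/
theorem continuationHull_probe (G : StochasticGraph U V) (v : V) (s : List U) (u : U)
    {x : U → ℝ} (hx : x ∈ G.continuationHull v (s ++ [u])) :
    G.p u v • Pi.single u 1 + (1 - G.p u v) • x ∈ G.continuationHull v s := by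
  let φ : (U → ℝ) →ᵃ[ℝ] (U → ℝ) :=
    AffineMap.const ℝ (U → ℝ) (G.p u v • Pi.single u (1 : ℝ) : U → ℝ) +
      (1 - G.p u v) • AffineMap.id ℝ (U → ℝ)
  suffices h : G.continuationHull v (s ++ [u]) ⊆ φ ⁻¹' G.continuationHull v s from h hx
  refine convexHull_min ?_ ((convex_convexHull ℝ _).affine_preimage φ)
  rintro _ ⟨e, he, rfl⟩
  have he' : s ++ u :: e ∈ G.C v := by simpa using he
  have hnd := (List.nodup_append.1 (G.nodup_of_mem _ _ he')).2.1
  refine subset_convexHull ℝ _ ⟨u :: e, he', ?_⟩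
  simp [φ, G.firstActiveProb_cons v (List.nodup_cons.1 hnd).1]

theorem exists_weights_of_mem_continuationHull (G : StochasticGraph U V) (v : V) {x : U → ℝ}
    (hx : x ∈ G.continuationHull v []) :
    ∃ c : List U → ℝ, (∀ e, 0 ≤ c e) ∧ ∑ e ∈ G.C v, c e = 1 ∧
      ∀ u, x u = ∑ e ∈ G.C v, c e * G.firstActiveProb v e u := by
  suffices h : G.continuationHull v [] ⊆ {x : U → ℝ | ∃ c : List U → ℝ, (∀ e, 0 ≤ c e) ∧
      ∑ e ∈ G.C v, c e = 1 ∧ ∀ u, x u = ∑ e ∈ G.C v, c e * G.firstActiveProb v e u} from h hx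
  refine convexHull_min ?_ ?_
  · rintro _ ⟨e, he, rfl⟩
    have he' : e ∈ G.C v := he
    refine ⟨Pi.single e 1, fun e' => ?_, by simp [Pi.single_apply, he'],
      fun u => by simp [Pi.single_apply, he']⟩
    by_cases h : e' = e <;> simp [h]
  · rintro x ⟨c, hc, hc₁, hcx⟩ y ⟨d, hd, hd₁, hdy⟩ a b ha hb hab
    refine ⟨fun e => a * c e + b * d e, fun e => ?_, ?_, fun u => ?_⟩
    · exact add_nonneg (mul_nonneg ha (hc e)) (mul_nonneg hb (hd e))
    · rw [Finset.sum_add_distrib, ← Finset.mul_sum, ← Finset.mul_sum, hc₁, hd₁]; linarith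
    · simp only [Pi.add_apply, Pi.smul_apply, smul_eq_mul, hcx, hdy, Finset.mul_sum, add_mul,
        Finset.sum_add_distrib, mul_assoc]

end Strings

/-! ### Acceptance probabilities and the offline optimum -/

section Marginals

variable {U V : Type*} [Fintype U] [Fintype V]

theorem stateProb_nonneg (G : StochasticGraph U V) (st : U × V → Bool) : 0 ≤ G.stateProb st := by
  refine Finset.prod_nonneg fun e _ => ?_
  split_ifs
  · exact G.p_nonneg _ _
  · linarith [G.p_le_one e.1 e.2]

variable [DecidableEq U] [DecidableEq V]

theorem sum_stateProb (G : StochasticGraph U V) : ∑ st, G.stateProb st = 1 := by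
  have h := Finset.prod_univ_sum (fun _ : U × V => (Finset.univ : Finset Bool))
    (fun e b => if b then G.p e.1 e.2 else 1 - G.p e.1 e.2)
  simp only [Fintype.piFinset_univ] at h
  simp only [stateProb]
  rw [← h]
  simp

/-- The expectation of a function of the edge states, by conditioning on the state of one edge. -/
theorem sum_stateProb_mul (G : StochasticGraph U V) (F : (U × V → Bool) → ℝ) (u : U) (v : V) :
    ∑ st, G.stateProb st * F st =
      G.p u v * ∑ st, G.stateProb st * F (Function.update st (u, v) true) +
      (1 - G.p u v) * ∑ st, G.stateProb st * F (Function.update st (u, v) false) := by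
  let E := Equiv.funSplitAt (u, v) Bool
  let Q : ({e : U × V // e ≠ (u, v)} → Bool) → ℝ := fun g =>
    ∏ e, if g e then G.p e.1.1 e.1.2 else 1 - G.p e.1.1 e.1.2
  have hP : ∀ b g, G.stateProb (E.symm (b, g)) =
      (if b then G.p u v else 1 - G.p u v) * Q g := by
    intro b g
    rw [stateProb, Fintype.prod_eq_mul_prod_subtype_ne _ (u, v)]
    have h : ∀ e : {e : U × V // e ≠ (u, v)}, E.symm (b, g) e = g e := fun e => by
      simp only [E, Equiv.funSplitAt_symm_apply, dif_neg e.2]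
    have h' : E.symm (b, g) (u, v) = b := by simp [E, Equiv.funSplitAt_symm_apply]
    simp only [h, h', Q]
  have hup : ∀ b b' g, Function.update (E.symm (b, g)) (u, v) b' = E.symm (b', g) := by
    intro b b' g
    ext e
    rcases eq_or_ne e (u, v) with rfl | h
    · simp [E, Equiv.funSplitAt_symm_apply]
    · simp [E, Equiv.funSplitAt_symm_apply, h]
  simp only [← E.symm.sum_comp, Fintype.sum_prod_type, hP, hup, Fintype.sum_bool, if_true,
    if_false, Bool.false_eq_true, mul_assoc, ← Finset.mul_sum]
  ring

/-- The probability that the strategy `A` accepts the edge `f`. -/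
def marginal (G : StochasticGraph U V) (A : ProbingTree U V) (f : U × V) : ℝ :=
  ∑ st, G.stateProb st * if f ∈ A.run st then 1 else 0

/-- Condition on the state of the probed edge. By validity neither subtree looks at that edge again,
so fixing its state does not affect them. -/
theorem marginal_probe (G : StochasticGraph U V) {u : U} {v : V} {acc : Bool}
    {active inactive : ProbingTree U V} {s : V → List U} {M : Finset (U × V)}
    (hA : (ProbingTree.probe u v acc active inactive).ValidFrom G s M) (f : U × V) :
    G.marginal (.probe u v acc active inactive) f =
      G.p u v * (if acc = true ∧ f = (u, v) then 1 else G.marginal active f) +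
      (1 - G.p u v) * G.marginal inactive f := by
  obtain ⟨-, -, h₁, h₂⟩ := hA
  have hmem : u ∈ Function.update s v (s v ++ [u]) v := by simp
  simp only [marginal]
  rw [G.sum_stateProb_mul _ u v]
  simp only [ProbingTree.run, Function.update_self, if_true, if_false, Bool.false_eq_true,
    ProbingTree.run_update_of_mem _ h₁ hmem, ProbingTree.run_update_of_mem _ h₂ hmem]
  congr 2
  cases acc
  · simp
  · by_cases h : f = (u, v)
    · simp [h, G.sum_stateProb]
    · simp [h]

theorem marginal_eq_zero (G : StochasticGraph U V) {A : ProbingTree U V} {s : V → List U}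
    {M : Finset (U × V)} (hA : A.ValidFrom G s M) {f g : U × V} (hg : g ∈ M) (h : g.2 = f.2) :
    G.marginal A f = 0 := by
  refine Finset.sum_eq_zero fun st _ => ?_
  rw [if_neg fun hf => (A.disjoint_of_mem_run hA hg hf).2 h, mul_zero]

theorem marginal_mem_continuationHull (G : StochasticGraph U V) (v : V) (A : ProbingTree U V)
    {s : V → List U} {M : Finset (U × V)} (hA : A.ValidFrom G s M) (hM : ∀ f ∈ M, f.2 ≠ v)
    (hs : s v ∈ G.C v) : (fun u => G.marginal A (u, v)) ∈ G.continuationHull v (s v) := by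
  induction A generalizing s M with
  | halt =>
    -- Halting corresponds to probing the empty string.
    refine subset_convexHull ℝ _ ⟨[], by simpa using hs, ?_⟩
    ext u
    simp [firstActiveProb_nil, marginal, ProbingTree.run]
  | probe u' v' acc active inactive ih₁ ih₂ =>
    have hA' := hA
    obtain ⟨hC, hacc, h₁, h₂⟩ := hA
    have hp₀ := G.p_nonneg u' v'
    have hp₁ : 0 ≤ 1 - G.p u' v' := by linarith [G.p_le_one u' v']
    have hconv : ∀ t, Convex ℝ (G.continuationHull v t) := fun t => convex_convexHull ℝ _
    simp only [G.marginal_probe hA']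
    rcases eq_or_ne v v' with rfl | hv
    · have hs' : Function.update s v (s v ++ [u']) v = s v ++ [u'] := by simp
      have i₂ := ih₂ h₂ hM (by rwa [hs'])
      rw [hs'] at i₂
      cases acc
      -- Rejecting: both branches continue after `s v ++ [u']`, and their mixture remains in the
      -- larger hull.
      · have i₁ := ih₁ h₁ (by simpa using hM) (by rwa [hs'])
        rw [hs'] at i₁
        simpa [Pi.add_def, Pi.smul_def] using G.continuationHull_append_subset v (s v) u'
          ((hconv _) i₁ i₂ hp₀ hp₁ (by ring))
      -- Accepting: `v` is now matched, so the active branch contributes only the unit vector at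
      -- `u'`.
      · convert G.continuationHull_probe v (s v) u' i₂ using 1
        ext u
        have h0 : G.marginal active (u, v) = 0 :=
          G.marginal_eq_zero h₁ (g := (u', v)) (by simp) rfl
        by_cases h : u = u' <;> simp [h, h0]
    -- A probe elsewhere leaves the string at `v` unchanged and acts as a biased coin.
    · have hs' : Function.update s v' (s v' ++ [u']) v = s v := by simp [hv]
      have i₂ := ih₂ h₂ hM (by rwa [hs'])
      have i₁ := ih₁ h₁ (by
        cases acc
        · simpa using hM
        · intro f hf
          rcases Finset.mem_insert.1 hf with rfl | hf
          · exact hv.symm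
          · exact hM f hf) (by rwa [hs'])
      rw [hs'] at i₁ i₂
      simpa [hv, Pi.add_def, Pi.smul_def] using (hconv _) i₁ i₂ hp₀ hp₁ (by ring)

theorem sum_marginal_le_one (G : StochasticGraph U V) (A : G.DetAlg) (u : U) :
    ∑ v, G.marginal A.1 (u, v) ≤ 1 := by
  simp only [marginal]
  rw [Finset.sum_comm]
  refine le_of_le_of_eq ?_ G.sum_stateProb
  refine Finset.sum_le_sum fun st _ => ?_
  rw [← Finset.mul_sum]
  refine mul_le_of_le_one_right (G.stateProb_nonneg st) ?_
  rw [Finset.sum_boole, Nat.cast_le_one, Finset.card_le_one]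
  intro v hv v' hv'
  simp only [Finset.mem_filter, Finset.mem_univ, true_and] at hv hv'
  exact (Prod.mk.inj (A.1.eq_of_mem_run A.2 hv hv' rfl)).2

theorem detValue_eq_sum_marginal (G : StochasticGraph U V) (A : G.DetAlg) :
    G.detValue A = ∑ v, ∑ u, G.w u v * G.marginal A.1 (u, v) := by
  rw [← Fintype.sum_prod_type_right (fun f : U × V => G.w f.1 f.2 * G.marginal A.1 f)]
  simp only [detValue, marginal, Finset.mul_sum]
  rw [Finset.sum_comm]
  refine Finset.sum_congr rfl fun st _ => ?_
  rw [← Finset.mul_sum, ← Finset.univ_inter (A.1.run st), ← Finset.sum_ite_mem, Finset.mul_sum]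
  refine Finset.sum_congr rfl fun f _ => ?_
  simp only [Finset.univ_inter]
  split_ifs <;> ring

/-- The vector of acceptance probabilities of an algorithm at `v` is a mixture of those of strings
whose first active edge is accepted. -/
theorem exists_weights_marginal (G : StochasticGraph U V) (A : G.DetAlg) (v : V) :
    ∃ c : List U → ℝ, (∀ e, 0 ≤ c e) ∧ ∑ e ∈ G.C v, c e = 1 ∧
      ∀ u, G.marginal A.1 (u, v) = ∑ e ∈ G.C v, c e * G.firstActiveProb v e u :=
  G.exists_weights_of_mem_continuationHull v
    (G.marginal_mem_continuationHull v A.1 A.2 (by simp) (G.nil_mem v))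

/-- The value depends only on the map from edge states to returned sets, and there are finitely many
such maps. -/
theorem exists_detValue_max (G : StochasticGraph U V) :
    ∃ A : G.DetAlg, ∀ A', G.detValue A' ≤ G.detValue A := by
  have hfin : (Set.range G.detValue).Finite := by
    refine (Set.finite_range fun R : (U × V → Bool) → Finset (U × V) =>
      ∑ st, G.stateProb st * ∑ e ∈ R st, G.w e.1 e.2).subset ?_
    rintro _ ⟨A, rfl⟩
    exact ⟨fun st => A.1.run st, rfl⟩
  have hne : (Set.range G.detValue).Nonempty := ⟨_, ⟨.halt, trivial⟩, rfl⟩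
  obtain ⟨_, ⟨A, rfl⟩, hA⟩ := Set.exists_max_image _ id hfin hne
  exact ⟨A, fun A' => hA _ ⟨A', rfl⟩⟩

theorem exists_detValue_isGreatest (G : StochasticGraph U V) :
    ∃ A : G.DetAlg, IsGreatest G.offlineValues (G.detValue A) := by
  obtain ⟨A, hA⟩ := G.exists_detValue_max
  refine ⟨A, ⟨PMF.pure A, ?_⟩, ?_⟩
  · rw [algValue, tsum_eq_single A fun A' h => by simp [PMF.pure_apply, h]]
    simp
  · rintro _ ⟨μ, rfl⟩
    have hsum : HasSum (fun A' => (μ A').toReal) 1 := by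
      have h := ENNReal.hasSum_toReal μ.tsum_coe_ne_top
      rwa [← ENNReal.tsum_toReal_eq μ.apply_ne_top, μ.tsum_coe, ENNReal.toReal_one] at h
    -- The bound gives summability, without which `tsum` would take its default value and could not
    -- be compared termwise.
    have hbdd : ∃ K, ∀ A' : G.DetAlg, |G.detValue A'| ≤ K := by
      refine ⟨∑ st, G.stateProb st * ∑ e : U × V, |G.w e.1 e.2|, fun A' => ?_⟩
      refine (Finset.abs_sum_le_sum_abs _ _).trans (Finset.sum_le_sum fun st _ => ?_)
      rw [abs_mul, abs_of_nonneg (G.stateProb_nonneg st)]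
      refine mul_le_mul_of_nonneg_left ?_ (G.stateProb_nonneg st)
      exact (Finset.abs_sum_le_sum_abs _ _).trans
        (Finset.sum_le_univ_sum_of_nonneg fun _ => abs_nonneg _)
    obtain ⟨K, hK⟩ := hbdd
    have hs : Summable fun A' => (μ A').toReal * G.detValue A' := by
      refine Summable.of_norm_bounded (hsum.summable.mul_right K) fun A' => ?_
      rw [Real.norm_eq_abs, abs_mul, abs_of_nonneg ENNReal.toReal_nonneg]
      exact mul_le_mul_of_nonneg_left (hK A') ENNReal.toReal_nonneg
    have := hs.tsum_le_tsum
      (fun A' => mul_le_mul_of_nonneg_left (hA A') ENNReal.toReal_nonneg)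
      (hsum.summable.mul_right (G.detValue A))
    rwa [tsum_mul_right, hsum.tsum_eq, one_mul] at this

end Marginals

/-! ### Averaging over the random types -/

section Types

variable {U B : Type*} {n : ℕ}

/-- The probability that the online vertices have the types `τ`. -/
def typeProb (D : Fin n → PMF B) (τ : Fin n → B) : ℝ :=
  ∏ i, (D i (τ i)).toReal

theorem typeProb_nonneg (D : Fin n → PMF B) (τ : Fin n → B) : 0 ≤ typeProb D τ :=
  Finset.prod_nonneg fun _ _ => ENNReal.toReal_nonneg

variable [Fintype B]

theorem sum_pmf_toReal (μ : PMF B) : ∑ b, (μ b).toReal = 1 := by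
  rw [← ENNReal.toReal_sum fun b _ => μ.apply_ne_top b, ← tsum_fintype (L := .unconditional B), μ.tsum_coe,
    ENNReal.toReal_one]

theorem sum_typeProb (D : Fin n → PMF B) : ∑ τ, typeProb D τ = 1 := by
  classical
  have h := Finset.prod_univ_sum (fun _ : Fin n => (Finset.univ : Finset B))
    (fun i b => (D i b).toReal)
  simp only [Fintype.piFinset_univ, sum_pmf_toReal, Finset.prod_const_one] at h
  exact h.symm

theorem sum_typeProb_eq_type [DecidableEq B] (D : Fin n → PMF B) (i : Fin n) (b : B) :
    ∑ τ, (if τ i = b then typeProb D τ else 0) = (D i b).toReal := by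
  -- Putting the indicator of `b` into the `i`-th factor alone makes the other factors sum to 1.
  have h := Finset.prod_univ_sum (fun _ : Fin n => (Finset.univ : Finset B))
    (fun j a => (D j a).toReal * if j = i → a = b then 1 else 0)
  rw [Fintype.piFinset_univ] at h
  have hr : ∀ τ : Fin n → B, ∏ j, ((D j (τ j)).toReal * if j = i → τ j = b then 1 else 0) =
      if τ i = b then typeProb D τ else 0 := by
    intro τ
    rw [Finset.prod_mul_distrib, Finset.prod_ite_zero]
    simp [typeProb]
  rw [← Finset.sum_congr rfl fun τ _ => hr τ, ← h, Finset.prod_eq_single i]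
  · simp
  · intro j _ hj
    simp [hj, sum_pmf_toReal]
  · simp

/-- The solution to LP-config-id in which `c τ i` is the mixture of strings used at the `i`-th online
vertex if the types are `τ`. -/
def mixedSolution [DecidableEq B] (D : Fin n → PMF B) (c : (Fin n → B) → Fin n → List U → ℝ)
    (i : Fin n) (b : B) (e : List U) : ℝ :=
  ∑ τ, if τ i = b then typeProb D τ * c τ i e else 0

theorem sum_mul_mixedSolution [DecidableEq B] (H : StochasticGraph U B) (D : Fin n → PMF B)
    (c : (Fin n → B) → Fin n → List U → ℝ) (g : B → List U → ℝ) :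
    ∑ i, ∑ b, ∑ e ∈ H.C b, mixedSolution D c i b e * g b e =
      ∑ τ, typeProb D τ * ∑ i, ∑ e ∈ H.C (τ i), c τ i e * g (τ i) e := by
  simp only [mixedSolution, Finset.mul_sum, Finset.sum_mul]
  rw [Finset.sum_comm (s := (Finset.univ : Finset (Fin n → B)))]
  refine Finset.sum_congr rfl fun i _ => ?_
  refine ((Finset.sum_congr rfl fun b _ => Finset.sum_comm).trans Finset.sum_comm).trans ?_
  refine Finset.sum_congr rfl fun τ _ => ?_
  rw [Finset.sum_eq_single (τ i)]
  · simp [mul_assoc]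
  · intro b _ hb
    simp [hb.symm]
  · simp

end Types

/-! ### The linear program -/

section LinearProgram

variable {U B : Type*} [DecidableEq U] {n : ℕ}

theorem sum_filter_qBefore_mul (H : StochasticGraph U B) (b : B) (u : U) (y : List U → ℝ) :
    ∑ e ∈ H.C b with u ∈ e, H.p u b * H.qBefore b e u * y e =
      ∑ e ∈ H.C b, y e * H.firstActiveProb b e u := by
  rw [Finset.sum_filter]
  refine Finset.sum_congr rfl fun e _ => ?_
  unfold firstActiveProb
  split_ifs <;> ring

variable [Fintype B]

/-- Coordinates outside `C b` are unconstrained, so the feasible set itself need not be compact.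
Setting them to 0 preserves the objective and leaves a closed part of a product of compact sets. -/
theorem isCompact_lpValues (H : StochasticGraph U B) (D : Fin n → PMF B) :
    IsCompact (H.lpValues D) := by
  classical
  let K : Set (Fin n → B → List U → ℝ) := Set.univ.pi fun _ => Set.univ.pi fun b =>
    Set.univ.pi fun e => if e ∈ H.C b then Set.Icc 0 1 else {0}
  have hK : IsCompact K := isCompact_univ_pi fun _ => isCompact_univ_pi fun b =>
    isCompact_univ_pi fun e => by split_ifs; exacts [isCompact_Icc, isCompact_singleton]
  let S : Set (Fin n → B → List U → ℝ) :=
    (⋂ u, {x | ∑ i, ∑ b, ∑ e ∈ H.C b with u ∈ e, H.p u b * H.qBefore b e u * x i b e ≤ 1}) ∩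
      ⋂ i, ⋂ b, {x | ∑ e ∈ H.C b, x i b e = (D i b).toReal}
  have hS : IsClosed S := by
    refine (isClosed_iInter fun u => isClosed_le (by fun_prop) continuous_const).inter
      (isClosed_iInter fun i => isClosed_iInter fun b => isClosed_eq (by fun_prop)
        continuous_const)
  have hcont : Continuous fun x : Fin n → B → List U → ℝ => H.lpObjective x := by
    unfold lpObjective
    fun_prop
  have himg : H.lpValues D = H.lpObjective '' (K ∩ S) := by
    ext t
    constructor
    · rintro ⟨x, hx, rfl⟩
      let y : Fin n → B → List U → ℝ := fun i b e => if e ∈ H.C b then x i b e else 0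
      have hy : ∀ i b, ∀ e ∈ H.C b, y i b e = x i b e := fun i b e he => if_pos he
      refine ⟨y, ⟨?_, ?_, ?_⟩, ?_⟩
      · intro i _ b _ e _
        by_cases he : e ∈ H.C b
        · simp only [he, if_true, hy i b e he]
          refine ⟨hx.nonneg i b e he, ?_⟩
          calc x i b e ≤ ∑ e ∈ H.C b, x i b e :=
                Finset.single_le_sum (fun e he => hx.nonneg i b e he) he
            _ = (D i b).toReal := hx.distribution i b
            _ ≤ 1 := ENNReal.toReal_le_of_le_ofReal zero_le_one (by simpa using (D i).coe_le_one b)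
        · simp [he, y]
      · refine Set.mem_iInter.2 fun u => le_of_eq_of_le ?_ (hx.matching u)
        refine Finset.sum_congr rfl fun i _ => Finset.sum_congr rfl fun b _ =>
          Finset.sum_congr rfl fun e he => ?_
        rw [hy i b e (Finset.mem_filter.1 he).1]
      · refine Set.mem_iInter.2 fun i => Set.mem_iInter.2 fun b => ?_
        exact (Finset.sum_congr rfl (hy i b)).trans (hx.distribution i b)
      · refine Finset.sum_congr rfl fun i _ => Finset.sum_congr rfl fun b _ =>
          Finset.sum_congr rfl fun e he => ?_
        rw [hy i b e he]
    · rintro ⟨x, ⟨hxK, hx₁, hx₂⟩, rfl⟩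
      refine ⟨x, ⟨fun u => Set.mem_iInter.1 hx₁ u,
        fun i b => Set.mem_iInter.1 (Set.mem_iInter.1 hx₂ i) b, fun i b e he => ?_⟩, rfl⟩
      have := hxK i trivial b trivial e trivial
      simp only [he, if_true] at this
      exact this.1
  rw [himg]
  exact (hK.inter_right hS).image hcont

theorem lpValues_nonempty (H : StochasticGraph U B) (D : Fin n → PMF B) :
    (H.lpValues D).Nonempty := by
  refine ⟨_, fun i b e => if e = [] then (D i b).toReal else 0, ⟨fun u => ?_, fun i b => ?_,
    fun i b e _ => ?_⟩, rfl⟩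
  · refine le_of_eq_of_le (Finset.sum_eq_zero fun i _ => Finset.sum_eq_zero fun b _ =>
      Finset.sum_eq_zero fun e he => ?_) zero_le_one
    have : e ≠ [] := List.ne_nil_of_mem (Finset.mem_filter.1 he).2
    simp [this]
  · simp [H.nil_mem b]
  · split_ifs <;> simp

theorem isGreatest_LPOPT (H : StochasticGraph U B) (D : Fin n → PMF B) :
    IsGreatest (H.lpValues D) (H.LPOPT D) :=
  (H.isCompact_lpValues D).isGreatest_sSup (H.lpValues_nonempty D)

theorem expectedOPT_mem_lpValues [Fintype U] (H : StochasticGraph U B) (D : Fin n → PMF B) :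
    H.expectedOPT D ∈ H.lpValues D := by
  classical
  choose A hA using fun τ : Fin n → B => (H.sample τ).exists_detValue_isGreatest
  choose c hc₀ hc₁ hc using fun (τ : Fin n → B) (i : Fin n) =>
    (H.sample τ).exists_weights_marginal (A τ) i
  refine ⟨mixedSolution D c, ⟨fun u => ?_, fun i b => ?_, fun i b e _ => ?_⟩, ?_⟩
  · simp only [sum_filter_qBefore_mul]
    rw [sum_mul_mixedSolution H D c fun b e => H.firstActiveProb b e u, ← sum_typeProb D]
    refine Finset.sum_le_sum fun τ _ => mul_le_of_le_one_right (typeProb_nonneg D τ) ?_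
    refine le_of_eq_of_le (Finset.sum_congr rfl fun i _ => ?_)
      ((H.sample τ).sum_marginal_le_one (A τ) u)
    exact (hc τ i u).symm
  -- For each `τ` the weights sum to 1, which leaves the probability that `τ i = b`.
  · rw [← sum_typeProb_eq_type D i b]
    simp only [mixedSolution]
    rw [Finset.sum_comm]
    refine Finset.sum_congr rfl fun τ _ => ?_
    split_ifs with h
    · subst h
      rw [← Finset.mul_sum]
      exact (congrArg _ (hc₁ τ i)).trans (mul_one _)
    · simp
  · refine Finset.sum_nonneg fun τ _ => ?_
    split_ifs
    exacts [mul_nonneg (typeProb_nonneg D τ) (hc₀ τ i e), le_rfl]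
  · simp only [lpObjective, mul_comm (H.val _ _)]
    rw [sum_mul_mixedSolution H D c fun b e => H.val b e]
    refine Finset.sum_congr rfl fun τ _ => ?_
    change _ = typeProb D τ * _
    rw [OPT, (hA τ).csSup_eq, detValue_eq_sum_marginal]
    congr 1
    refine Finset.sum_congr rfl fun i _ => ?_
    simp only [hc τ i, Finset.mul_sum]
    rw [Finset.sum_comm]
    refine Finset.sum_congr rfl fun e he => ?_
    rw [H.val_eq_sum (τ i) (H.nodup_of_mem _ _ he), Finset.mul_sum]
    refine Finset.sum_congr rfl fun u _ => ?_
    exact mul_left_comm _ _ _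

end LinearProgram

end StochasticGraph

theorem mainTheorem5 {U B : Type*} [Fintype U] [DecidableEq U] [Fintype B] {n : ℕ}
    (H : StochasticGraph U B) (D : Fin n → PMF B) :
    (∀ τ : Fin n → B, IsGreatest (H.sample τ).offlineValues (H.sample τ).OPT) ∧
    IsGreatest (H.lpValues D) (H.LPOPT D) ∧
    H.expectedOPT D ≤ H.LPOPT D := by
  refine ⟨fun τ => ?_, H.isGreatest_LPOPT D,
    (H.isGreatest_LPOPT D).2 (H.expectedOPT_mem_lpValues D)⟩
  obtain ⟨A, hA⟩ := (H.sample τ).exists_detValue_isGreatest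
  rwa [StochasticGraph.OPT, hA.csSup_eq]
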